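/- Consider a stochastic game with nonempty finite state set $K$, nonempty finite action sets $A$ (player 1, informed) and $B$ (player 2, uninformed), payoff matrices $M_k\in\mathbb{R}^{A\times B}$ for $k\in K$, and transition matrices $Q_a\in\mathbb{R}^{K\times K}$ for $a\in A$, where each row $Q_a(k,\cdot)$ is a probability distribution on $K$. Let $n\ge 1$ and $\alpha\in\mathbb{R}^{K}$. In the $n$-stage dual game $G_n(\alpha)$, player 1 chooses a distribution $p\in\Delta(K)$, from which the initial state $k_1$ is drawn. At each stage $t=1,\dots,n$, player 1 observes the current state $k_t$, player 2 does not, both players simultaneously choose actions $a_t\in A$ and $b_t\in B$, both of which are then publicly observed, and $k_{t+1}$ is drawn from $Q_{a_t}(k_t,\cdot)$. Behavior strategies are $\sigma=(\sigma_t)$, $\sigma_t:K^t\times A^{t-1}\times B^{t-1}\to\Delta(A)$, for player 1, and $\tau=(\tau_t)$, $\tau_t:A^{t-1}\times B^{t-1}\to\Delta(B)$, for player 2. Player 1 maximizes and player 2 minimizes $$g(p,\sigma,\tau)=\mathbf{E}_{p,\sigma,\tau,Q}\Bigl(\alpha(k_1)+\sum_{t=1}^n M_{k_t}(a_t,b_t)\Bigr).$$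 Then this game has a value $w_n(\alpha)=\max_{p,\sigma}\min_\tau g=\min_\tau\max_{p,\sigma}g$, and it equals the (attained) optimal value of the linear program \begin{align*} w_n(\alpha)=\min_{y,\ell,\hat\ell}\ & \hat\ell\\ \text{s.t. } & \alpha(k)+\ell_{(k,\emptyset)}\le\hat\ell && \forall k\in K,\\ & \sum_{k_t\in K}\ell_{(S_{t-1},k_t),(I_{t-1},a_{t-1})}\le \ell_{S_{t-1},I_{t-1}} && \forall t=2,\dots,n,\ S_{t-1}\in K^{t-1},\ I_{t-1}\in A^{t-2},\ a_{t-1}\in A,\\ & \prod_{t=1}^{n-1}Q_{a_t}(k_t,k_{t+1})\sum_{t=1}^n M_{k_t}(a_t,:)\,y_{I_t}\le \ell_{S_n,I_n} && \forall S_n=(k_1,\dots,k_n)\in K^n,\ (a_1,\dots,a_n)\in A^n,\ I_t=(a_1,\dots,a_{t-1}), \end{align*} where $\hat\ell\in\mathbb{R}$, $y=(y_{I_t})$ ranges over all families with $y_{I_t}\in\Delta(B)$ for $I_t\in A^{t-1}$, $t=1,\dots,n$, and $\ell=(\ell_{S_t,I_t})$ over all families of reals indexed by $(S_t,I_t)\in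 K^t\times A^{t-1}$, $t=1,\dots,n$. -/

import Mathlib

open scoped BigOperators

noncomputable section

/-- The data `(K, A, B, M, Q)` shared by the primal and the dual game: `M k` is the payoff matrix
in state `k`, and `Q a k k'` is the probability that the next state is `k'` when the current state
is `k` and player 1 plays `a`. -/
structure StochGame (K A B : Type*) [Fintype K] where
  M : K → Matrix A B ℝ
  Q : A → Matrix K K ℝ
  Q_mem : ∀ a k, Q a k ∈ stdSimplex ℝ K

namespace StochGame

/-- The first `m` entries of a sequence of length `n`. -/
def take {X : Type*} {m n : ℕ} (h : m ≤ n) (x : Fin n → X) : Fin m → X :=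
  fun i => x (Fin.castLE h i)

section Strategies

variable (K A B : Type*) [Fintype A] [Fintype B] (m : ℕ)

/-- Behavior strategies of player 1 in a game with `n = m + 1` stages. Stages are numbered
`0, …, m`; at stage `t` player 1 knows `t + 1` states (the current one included), and `t` past
actions of either player. -/
abbrev Strategy1 : Type _ :=
  (t : Fin (m + 1)) → (Fin (t.val + 1) → K) → (Fin t.val → A) → (Fin t.val → B) → stdSimplex ℝ A

/-- Behavior strategies of player 2 in a game with `n = m + 1` stages: player 2 knows the past
actions of both players but no state. -/
abbrev Strategy2 : Type _ :=
  (t : Fin (m + 1)) → (Fin t.val → A) → (Fin t.val → B) → stdSimplex ℝ B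

/-- The set `Y` of families `y = (y_I)` with `y_I ∈ Δ(B)` for every stage and every past action
history `I` of player 1. -/
abbrev PlanY : Type _ :=
  (t : Fin (m + 1)) → (Fin t.val → A) → stdSimplex ℝ B

/-- The set `L` of families `ℓ = (ℓ_F)` of reals, where `F = (S, I)` runs over the full information
(states up to now, own past actions) of player 1 at every stage. -/
abbrev PlanL : Type _ :=
  (t : Fin (m + 1)) → (Fin (t.val + 1) → K) → (Fin t.val → A) → ℝ

end Strategies

variable {K A B : Type*} [Fintype K] [Fintype A] [Fintype B] (G : StochGame K A B) {m : ℕ}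

/-- The product of the transition probabilities along a play with `m + 1` stages. -/
def transProd (k : Fin (m + 1) → K) (a : Fin (m + 1) → A) : ℝ :=
  ∏ t : Fin m, G.Q (a t.castSucc) (k t.castSucc) (k t.succ)

/-- The probability of the play `(k, a, b)` under the initial law `p` and the strategies
`σ`, `τ`. -/
def playProb (p : stdSimplex ℝ K) (σ : Strategy1 K A B m) (τ : Strategy2 A B m)
    (k : Fin (m + 1) → K) (a : Fin (m + 1) → A) (b : Fin (m + 1) → B) : ℝ :=
  p.1 (k 0) * G.transProd k a *
    ∏ t : Fin (m + 1),
      (σ t (take t.isLt k) (take t.isLt.le a) (take t.isLt.le b)).1 (a t) *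
        (τ t (take t.isLt.le a) (take t.isLt.le b)).1 (b t)

/-- The payoff of the dual game with initial vector payoff `α`: the expectation of
`α(k_1) + ∑_t M_{k_t}(a_t, b_t)`, where player 1 draws the initial state from `p`. -/
def dualPayoff (α : K → ℝ) (p : stdSimplex ℝ K) (σ : Strategy1 K A B m)
    (τ : Strategy2 A B m) : ℝ :=
  ∑ k : Fin (m + 1) → K, ∑ a : Fin (m + 1) → A, ∑ b : Fin (m + 1) → B,
    G.playProb p σ τ k a b * (α (k 0) + ∑ t, G.M (k t) (a t) (b t))

/-- `w` is the value of the dual game with `m + 1` stages and initial vector payoff `α`: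
`w = max_{(p, σ)} min_τ g = min_τ max_{(p, σ)} g`, all maxima and minima being attained. -/
def IsDualValue (m : ℕ) (α : K → ℝ) (w : ℝ) : Prop :=
  IsGreatest {v : ℝ | ∃ (p : stdSimplex ℝ K) (σ : Strategy1 K A B m),
      IsLeast (Set.range fun τ : Strategy2 A B m => G.dualPayoff α p σ τ) v} w ∧
  IsLeast {v : ℝ | ∃ τ : Strategy2 A B m,
      IsGreatest (Set.range fun s : stdSimplex ℝ K × Strategy1 K A B m =>
        G.dualPayoff α s.1 s.2 τ) v} w

/-- The constraints on `(y, ℓ)` along the tree of histories: the recursive constraints linking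
consecutive stages, and the constraints at the last stage. -/
structure TreeFeasible (y : PlanY A B m) (l : PlanL K A m) : Prop where
  step : ∀ (t : Fin m) (S : Fin (t.val + 1) → K) (I : Fin t.val → A) (a : A),
    ∑ k' : K, l t.succ (Fin.snoc (α := fun _ => K) S k') (Fin.snoc (α := fun _ => A) I a)
      ≤ l t.castSucc S I
  last : ∀ (k : Fin (m + 1) → K) (a : Fin (m + 1) → A),
    G.transProd k a *
        ∑ t : Fin (m + 1), ∑ b : B, G.M (k t) (a t) b * (y t (take t.isLt.le a)).1 b
      ≤ l (Fin.last m) k (take (Nat.le_succ m) a)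

/-- Feasibility of `(y, ℓ, lhat)` in the linear program of the dual game. -/
structure DualFeasible (α : K → ℝ) (y : PlanY A B m) (l : PlanL K A m) (lhat : ℝ) : Prop where
  root : ∀ k : K, α k + l 0 (fun _ => k) Fin.elim0 ≤ lhat
  tree : G.TreeFeasible y l

end StochGame

end

noncomputable section

namespace StochGame

/-! The linear program encodes player 1's best reply to a plan `y`. Transitions depend only on
player 1's actions, so player 2's own past actions carry no information worth using. The root value
of a feasible `ℓ` bounds the payoff of every `(p, σ)` against `y` (`DualFeasible.dualPayoff_le`),
even when `σ` observes player 2's actions. Backward induction gives a feasible `ℓ` whose bound is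
attained by a reply that ignores those actions (`exists_treeFeasible_le_dualPayoff`).

Against such a strategy of player 1, only the averaged plan of player 2 matters
(`dualPayoff_eq_weightPayoff`), and the payoff is linear in player 1's realization weights and
affine in the plan. Both domains are compact and convex, so Sion's theorem yields a saddle point
(`exists_saddle`). Its payoff is guaranteed by player 1 against every `τ`, is feasible in the
program, and is therefore both the value and the optimum. -/

theorem sum_snoc {X : Type*} [Fintype X] {n : ℕ} (f : (Fin (n + 1) → X) → ℝ) :
    ∑ z, f z = ∑ z : Fin n → X, ∑ x : X, f (Fin.snoc (α := fun _ => X) z x) := by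
  rw [← (Fin.snocEquiv fun _ : Fin (n + 1) => X).sum_comp, Fintype.sum_prod_type_right]
  rfl

theorem take_snoc {X : Type*} {m n : ℕ} (h : m ≤ n) (h' : m ≤ n + 1) (z : Fin n → X) (x : X) :
    take h' (Fin.snoc (α := fun _ => X) z x) = take h z := by
  ext i
  have : Fin.castLE h' i = (Fin.castLE h i).castSucc := rfl
  simp only [take, this, Fin.snoc_castSucc]

@[simp]
theorem take_self {X : Type*} {n : ℕ} (h : n ≤ n) (z : Fin n → X) : take h z = z := rfl

theorem take_take {X : Type*} {l m n : ℕ} (h : l ≤ m) (h' : m ≤ n) (z : Fin n → X) :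
    take h (take h' z) = take (h.trans h') z := rfl

/-! ### Potentials along the tree of histories -/

section Reach

variable {K A B : Type*} [Fintype A] [Fintype B] {m : ℕ}

/-- The probability that the strategies choose the first `t` actions `I` and `J` along the
states `S`. -/
def reach (σ : Strategy1 K A B m) (τ : Strategy2 A B m) {t : ℕ} (h : t ≤ m + 1)
    (S : Fin t → K) (I : Fin t → A) (J : Fin t → B) : ℝ :=
  ∏ s : Fin t,
    (σ (Fin.castLE h s) (take s.isLt S) (take s.isLt.le I) (take s.isLt.le J)).1 (I s) *
      (τ (Fin.castLE h s) (take s.isLt.le I) (take s.isLt.le J)).1 (J s)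

theorem reach_nonneg (σ : Strategy1 K A B m) (τ : Strategy2 A B m) {t : ℕ} (h : t ≤ m + 1)
    (S : Fin t → K) (I : Fin t → A) (J : Fin t → B) : 0 ≤ reach σ τ h S I J :=
  Finset.prod_nonneg fun _ _ => mul_nonneg ((σ _ _ _ _).2.1 _) ((τ _ _ _).2.1 _)

theorem reach_snoc (σ : Strategy1 K A B m) (τ : Strategy2 A B m) {t : ℕ} (h : t + 1 ≤ m + 1)
    (S : Fin (t + 1) → K) (I : Fin t → A) (J : Fin t → B) (a : A) (b : B) :
    reach σ τ h S (Fin.snoc (α := fun _ => A) I a) (Fin.snoc (α := fun _ => B) J b) =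
      reach σ τ (Nat.le_of_succ_le h) (take (Nat.le_succ t) S) I J *
        ((σ ⟨t, h⟩ S I J).1 a * (τ ⟨t, h⟩ I J).1 b) := by
  rw [reach, Fin.prod_univ_castSucc]
  congr 1
  · refine Finset.prod_congr rfl fun s _ => ?_
    rw [Fin.snoc_castSucc, Fin.snoc_castSucc]
    rw [take_snoc (m := s.castSucc.val) s.isLt.le, take_snoc (m := s.castSucc.val) s.isLt.le]
    rfl
  · rw [Fin.snoc_last, Fin.snoc_last]
    rw [take_snoc (m := (Fin.last t).val) le_rfl, take_snoc (m := (Fin.last t).val) le_rfl]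
    rfl

/-- A potential on histories that does not increase in expectation bounds its final expectation
by its initial one. -/
theorem sum_reach_le [Fintype K] (p : stdSimplex ℝ K) (σ : Strategy1 K A B m) (τ : Strategy2 A B m)
    (V : (t : Fin (m + 1)) → (Fin (t.val + 1) → K) → (Fin t.val → A) → (Fin t.val → B) → ℝ)
    (u : (Fin (m + 1) → K) → (Fin (m + 1) → A) → (Fin (m + 1) → B) → ℝ)
    (step : ∀ (t : Fin m) (S : Fin (t.val + 1) → K) (I : Fin t.val → A) (J : Fin t.val → B),
      ∑ a, ∑ b, (σ t.castSucc S I J).1 a * (τ t.castSucc I J).1 b *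
        ∑ k', V t.succ (Fin.snoc (α := fun _ => K) S k') (Fin.snoc (α := fun _ => A) I a)
          (Fin.snoc (α := fun _ => B) J b) ≤ V t.castSucc S I J)
    (last : ∀ (S : Fin (m + 1) → K) (I : Fin m → A) (J : Fin m → B),
      ∑ a, ∑ b, (σ (Fin.last m) S I J).1 a * (τ (Fin.last m) I J).1 b *
        u S (Fin.snoc (α := fun _ => A) I a) (Fin.snoc (α := fun _ => B) J b)
          ≤ V (Fin.last m) S I J) :
    ∑ S, ∑ I, ∑ J, p.1 (S 0) * reach σ τ le_rfl S I J * u S I J ≤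
      ∑ k, p.1 k * V 0 (fun _ => k) Fin.elim0 Fin.elim0 := by
  -- Transition probabilities are absent from the weights: states are summed with counting measure,
  -- and `V` and `u` must carry the transition factors.
  have key : ∀ (t : ℕ) (h : t < m + 1),
      ∑ S : Fin (t + 1) → K, ∑ I : Fin t → A, ∑ J : Fin t → B,
        p.1 (S 0) * reach σ τ h.le (take (Nat.le_succ t) S) I J * V ⟨t, h⟩ S I J ≤
      ∑ k, p.1 k * V 0 (fun _ => k) Fin.elim0 Fin.elim0 := by
    intro t
    induction t with
    | zero =>
      intro h
      rw [← (Equiv.funUnique (Fin 1) K).symm.sum_comp]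
      refine Finset.sum_le_sum fun k _ => ?_
      rw [Fintype.sum_unique, Fintype.sum_unique]
      refine le_of_eq ?_
      rw [reach, Fin.prod_univ_zero, mul_one]
      congr 2
    | succ t ih =>
      intro h
      refine le_trans ?_ (ih (Nat.lt_of_succ_lt h))
      rw [sum_snoc]
      refine Finset.sum_le_sum fun S _ => ?_
      rw [Finset.sum_comm, sum_snoc]
      refine Finset.sum_le_sum fun I _ => ?_
      simp_rw [sum_snoc (X := B)]
      calc _ = ∑ J : Fin t → B,
            p.1 (S 0) * reach σ τ (Nat.lt_of_succ_lt h).le (take (Nat.le_succ t) S) I J *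
            ∑ a, ∑ b, (σ ⟨t, _⟩ S I J).1 a * (τ ⟨t, _⟩ I J).1 b *
              ∑ k', V ⟨t + 1, h⟩ (Fin.snoc (α := fun _ => K) S k')
                (Fin.snoc (α := fun _ => A) I a) (Fin.snoc (α := fun _ => B) J b) := by
            simp_rw [reach_snoc, take_snoc (le_refl (t + 1)), take_self, Finset.mul_sum]
            rw [Finset.sum_comm (s := (Finset.univ : Finset (Fin t → B)))]
            refine Finset.sum_congr rfl fun a _ => ?_
            rw [Finset.sum_comm]
            refine Finset.sum_congr rfl fun J _ => ?_
            rw [Finset.sum_comm]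
            refine Finset.sum_congr rfl fun b _ => Finset.sum_congr rfl fun k' _ => ?_
            rw [show Fin.snoc (α := fun _ => K) S k' 0 = S 0 from Fin.snoc_castSucc _ _ 0]
            ring
        _ ≤ _ := Finset.sum_le_sum fun J _ => mul_le_mul_of_nonneg_left
            (step ⟨t, Nat.lt_of_succ_lt_succ h⟩ S I J)
            (mul_nonneg (p.2.1 _) (reach_nonneg ..))
  refine le_trans ?_ (key m (Nat.lt_succ_self m))
  refine Finset.sum_le_sum fun S _ => ?_
  rw [sum_snoc]
  refine Finset.sum_le_sum fun I _ => ?_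
  simp_rw [sum_snoc (X := B)]
  rw [Finset.sum_comm]
  refine Finset.sum_le_sum fun J _ => ?_
  refine le_trans (le_of_eq ?_) (mul_le_mul_of_nonneg_left (last S I J)
    (mul_nonneg (p.2.1 _) (reach_nonneg ..)))
  simp_rw [reach_snoc, Finset.mul_sum]
  refine Finset.sum_congr rfl fun a _ => Finset.sum_congr rfl fun b _ => ?_
  simp only [Fin.last]
  ring

end Reach

/-! ### Best replies of player 1 to a plan -/

section BestReply

variable {K A B : Type*} [Fintype K] (G : StochGame K A B) {m : ℕ}

/-- The product of the transition probabilities along a history. -/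
def transHist {t : ℕ} (S : Fin (t + 1) → K) (I : Fin t → A) : ℝ :=
  ∏ s : Fin t, G.Q (I s) (S s.castSucc) (S s.succ)

theorem transHist_snoc {t : ℕ} (S : Fin (t + 1) → K) (I : Fin t → A) (k : K) (a : A) :
    G.transHist (Fin.snoc (α := fun _ => K) S k) (Fin.snoc (α := fun _ => A) I a) =
      G.transHist S I * G.Q a (S (Fin.last t)) k := by
  simp only [transHist]
  rw [Fin.prod_univ_castSucc]
  simp only [Fin.snoc_castSucc, Fin.snoc_last, Fin.succ_last, Fin.succ_castSucc]

theorem transProd_snoc (S : Fin (m + 1) → K) (I : Fin m → A) (a : A) :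
    G.transProd S (Fin.snoc (α := fun _ => A) I a) = G.transHist S I := by
  simp only [transHist, transProd, Fin.snoc_castSucc]

variable [Fintype B]

/-- The expected payoff at a stage at which player 2 follows `y`. -/
def planGain (y : PlanY A B m) (t : Fin (m + 1)) (k : K) (I : Fin t.val → A) (a : A) : ℝ :=
  ∑ b, G.M k a b * (y t I).1 b

/-- The difference between the payoffs received up to stage `t` and their conditional expectations
when player 2 follows `y`. -/
def excess (y : PlanY A B m) {t : ℕ} (h : t ≤ m + 1) (S : Fin t → K) (I : Fin t → A)
    (J : Fin t → B) : ℝ :=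
  ∑ s : Fin t, (G.M (S s) (I s) (J s) -
    G.planGain y (Fin.castLE h s) (S s) (take s.isLt.le I) (I s))

theorem excess_snoc (y : PlanY A B m) {t : ℕ} (h : t + 1 ≤ m + 1) (S : Fin (t + 1) → K)
    (I : Fin t → A) (J : Fin t → B) (a : A) (b : B) :
    G.excess y h S (Fin.snoc (α := fun _ => A) I a) (Fin.snoc (α := fun _ => B) J b) =
      G.excess y (Nat.le_of_succ_le h) (take (Nat.le_succ t) S) I J +
        (G.M (S (Fin.last t)) a b - G.planGain y ⟨t, h⟩ (S (Fin.last t)) I a) := by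
  rw [excess, Fin.sum_univ_castSucc]
  congr 1
  · refine Finset.sum_congr rfl fun s _ => ?_
    rw [Fin.snoc_castSucc, Fin.snoc_castSucc, take_snoc (m := s.castSucc.val) s.isLt.le]
    rfl
  · rw [Fin.snoc_last, Fin.snoc_last, take_snoc (m := (Fin.last t).val) le_rfl]
    rfl

variable [Fintype A]

/-- The deviation of `N a b` from its mean under `z` averages to zero, for each `a` separately. -/
theorem sum_mul_add_gain_sub (x : stdSimplex ℝ A) (z : stdSimplex ℝ B) (L : A → ℝ) (T e : ℝ)
    (N : A → B → ℝ) :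
    ∑ a, ∑ b, x.1 a * z.1 b * (L a + T * (e + (N a b - ∑ b', N a b' * z.1 b'))) =
      ∑ a, x.1 a * L a + T * e := by
  have hx : ∑ a, x.1 a = 1 := x.2.2
  have hz : ∑ b, z.1 b = 1 := z.2.2
  have h : ∀ a, ∑ b, x.1 a * z.1 b * (L a + T * (e + (N a b - ∑ b', N a b' * z.1 b'))) =
      x.1 a * L a + x.1 a * (T * e) := by
    intro a
    set c := ∑ b', N a b' * z.1 b' with hc
    calc _ = x.1 a * (L a + T * (e - c)) * ∑ b, z.1 b + x.1 a * T * ∑ b, N a b * z.1 b := by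
          rw [Finset.mul_sum, Finset.mul_sum, ← Finset.sum_add_distrib]
          exact Finset.sum_congr rfl fun b _ => by ring
      _ = _ := by rw [hz, ← hc]; ring
  simp_rw [h]
  rw [Finset.sum_add_distrib, ← Finset.sum_mul, hx, one_mul]

/-- The payoff weighted by the transition probabilities when player 2 follows `y`. -/
def planPayoff (y : PlanY A B m) (k : Fin (m + 1) → K) (a : Fin (m + 1) → A) : ℝ :=
  G.transProd k a * ∑ t : Fin (m + 1), G.planGain y t (k t) (take t.isLt.le a) (a t)

/-- The behavior strategy of player 2 that ignores their own past actions. -/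
def PlanY.toStrategy2 (y : PlanY A B m) : Strategy2 A B m := fun t I _ => y t I

theorem dualPayoff_eq_sum_reach (α : K → ℝ) (p : stdSimplex ℝ K) (σ : Strategy1 K A B m)
    (τ : Strategy2 A B m) :
    G.dualPayoff α p σ τ = ∑ k, ∑ a, ∑ b, p.1 (k 0) * reach σ τ le_rfl k a b *
      (G.transProd k a * (α (k 0) + ∑ t, G.M (k t) (a t) (b t))) := by
  refine Finset.sum_congr rfl fun k _ => Finset.sum_congr rfl fun a _ =>
    Finset.sum_congr rfl fun b _ => ?_
  have : G.playProb p σ τ k a b = p.1 (k 0) * G.transProd k a * reach σ τ le_rfl k a b := rfl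
  rw [this]
  ring

/-- The hypotheses are averaged over `σ`, not required for each action, so that the lemma also
applies to a best reply in the game with negated payoffs. -/
theorem dualPayoff_le_of_potential (α : K → ℝ) (p : stdSimplex ℝ K) (σ : Strategy1 K A B m)
    (y : PlanY A B m) (l : PlanL K A m)
    (step : ∀ (t : Fin m) (S : Fin (t.val + 1) → K) (I : Fin t.val → A) (J : Fin t.val → B),
      ∑ a, (σ t.castSucc S I J).1 a *
        ∑ k', l t.succ (Fin.snoc (α := fun _ => K) S k') (Fin.snoc (α := fun _ => A) I a)
          ≤ l t.castSucc S I)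
    (last : ∀ (S : Fin (m + 1) → K) (I : Fin m → A) (J : Fin m → B),
      ∑ a, (σ (Fin.last m) S I J).1 a *
        G.planPayoff y S (Fin.snoc (α := fun _ => A) I a) ≤ l (Fin.last m) S I) :
    G.dualPayoff α p σ y.toStrategy2 ≤ ∑ k, p.1 k * (α k + l 0 (fun _ => k) Fin.elim0) := by
  rw [dualPayoff_eq_sum_reach]
  -- The realized payoff is its conditional expectation plus `excess`, whose increments have mean
  -- zero under `y`. Hence `l` accounts for the expected part and the second summand is a martingale
  -- term.
  refine (sum_reach_le p σ y.toStrategy2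
    (fun t S I J => l t S I + G.transHist S I *
      (α (S 0) + G.excess y t.isLt.le (take (Nat.le_succ _) S) I J)) _ ?_ ?_).trans
    (le_of_eq ?_)
  · intro t S I J
    refine le_trans (le_of_eq ?_) (add_le_add_left (step t S I J) _)
    rw [← sum_mul_add_gain_sub _ (y t.castSucc I) _ _ _ (G.M (S (Fin.last _)))]
    refine Finset.sum_congr rfl fun a _ => Finset.sum_congr rfl fun b _ => ?_
    congr 1
    rw [Finset.sum_add_distrib]
    congr 1
    have hQ : ∑ k', G.Q a (S (Fin.last _)) k' = 1 := (G.Q_mem a (S (Fin.last _))).2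
    -- Row sums equal to 1 distribute the martingale term over the next state.
    rw [← mul_one (G.transHist S I), ← hQ, Finset.mul_sum, Finset.sum_mul]
    refine Finset.sum_congr rfl fun k' _ => ?_
    have h0 : Fin.snoc (α := fun _ => K) S k' 0 = S 0 := Fin.snoc_castSucc _ _ 0
    have ht := take_snoc (le_refl (t.val + 1)) (Nat.le_succ _) S k'
    have he := G.excess_snoc y (t := t.val) t.succ.isLt.le S I J a b
    have hT := G.transHist_snoc S I k' a
    simp only [Fin.val_succ] at *
    rw [hT, h0, ht, take_self, he, add_assoc]
    rfl
  · intro S I J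
    refine le_trans (le_of_eq ?_) (add_le_add_left (last S I J) _)
    rw [← sum_mul_add_gain_sub _ (y (Fin.last m) I) _ _ _ (G.M (S (Fin.last _)))]
    refine Finset.sum_congr rfl fun a _ => Finset.sum_congr rfl fun b _ => ?_
    have he := G.excess_snoc y le_rfl S I J a b
    congr 1
    rw [planPayoff, transProd_snoc, ← mul_add]
    congr 1
    rw [excess, Finset.sum_sub_distrib] at he
    change _ = _ + (α (S 0) + G.excess y _ _ I J +
      (G.M (S (Fin.last m)) a b - G.planGain y (Fin.last m) (S (Fin.last m)) I a))
    refine Eq.trans ?_ (congrArg₂ (· + ·) (Eq.refl (∑ t : Fin (m + 1), G.planGain y t (S t)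
      (take t.isLt.le (Fin.snoc (α := fun _ => A) I a)) (Fin.snoc (α := fun _ => A) I a t)))
      (add_assoc (α (S 0)) _ _).symm)
    refine Eq.trans ?_ (congrArg (fun r => _ + (α (S 0) + r)) he)
    simp only [Fin.castLE_rfl, id_eq]
    ring
  · refine Finset.sum_congr rfl fun k _ => ?_
    congr 1
    have h1 : ∀ (S : Fin 1 → K) (I : Fin 0 → A), G.transHist S I = 1 := fun _ _ =>
      Fin.prod_univ_zero _
    have h2 : ∀ (S : Fin 0 → K) (I : Fin 0 → A) (J : Fin 0 → B),
        G.excess y (Nat.zero_le (m + 1)) S I J = 0 := fun _ _ _ => Fin.sum_univ_zero _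
    exact (congrArg₂ (fun u v => l 0 (fun _ => k) Fin.elim0 + u * (α k + v)) (h1 _ _)
      (h2 _ _ _)).trans (by ring)

theorem sum_mul_le {X : Type*} [Fintype X] (x : stdSimplex ℝ X) (f : X → ℝ) (c : ℝ)
    (hf : ∀ i, f i ≤ c) : ∑ i, x.1 i * f i ≤ c := by
  calc _ ≤ ∑ i, x.1 i * c :=
        Finset.sum_le_sum fun i _ => mul_le_mul_of_nonneg_left (hf i) (x.2.1 i)
    _ = c := by rw [← Finset.sum_mul, show ∑ i, x.1 i = 1 from x.2.2, one_mul]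

omit [Fintype A] in
theorem DualFeasible.planPayoff_le {G : StochGame K A B} {α : K → ℝ} {y : PlanY A B m}
    {l : PlanL K A m} {lhat : ℝ}
    (h : G.DualFeasible α y l lhat) (S : Fin (m + 1) → K) (I : Fin m → A) (a : A) :
    G.planPayoff y S (Fin.snoc (α := fun _ => A) I a) ≤ l (Fin.last m) S I := by
  have := h.tree.last S (Fin.snoc (α := fun _ => A) I a)
  rwa [take_snoc le_rfl, take_self] at this

/-- A feasible point of the linear program bounds what player 1 can obtain against its plan. -/
theorem DualFeasible.dualPayoff_le {G : StochGame K A B} {α : K → ℝ} {y : PlanY A B m}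
    {l : PlanL K A m} {lhat : ℝ} (h : G.DualFeasible α y l lhat) (p : stdSimplex ℝ K)
    (σ : Strategy1 K A B m) : G.dualPayoff α p σ y.toStrategy2 ≤ lhat := by
  refine (G.dualPayoff_le_of_potential α p σ y l
    (fun t S I J => sum_mul_le _ _ _ fun a => h.tree.step t S I a)
    fun S I J => sum_mul_le _ _ _ fun a => h.planPayoff_le S I a).trans ?_
  exact sum_mul_le _ _ _ fun k => h.root k

/-- Player 1 has a best reply to every plan of player 2, and its payoff is the value at the root of
a feasible family. -/
theorem exists_treeFeasible_le_dualPayoff [Nonempty A] (α : K → ℝ) (y : PlanY A B m) :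
    ∃ l : PlanL K A m, G.TreeFeasible y l ∧
      ∃ c : (t : Fin (m + 1)) → (Fin (t.val + 1) → K) → (Fin t.val → A) → stdSimplex ℝ A,
        ∀ p : stdSimplex ℝ K, ∑ k, p.1 k * (α k + l 0 (fun _ => k) Fin.elim0) ≤
          G.dualPayoff α p (fun t S I _ => c t S I) y.toStrategy2 := by
  classical
  let vertex : A → stdSimplex ℝ A := fun a => ⟨Pi.single a 1, single_mem_stdSimplex ℝ a⟩
  have hvertex : ∀ (a : A) (f : A → ℝ), ∑ i, (vertex a).1 i * f i = f a := by
    intro a f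
    simp [vertex, Pi.single_apply]
  let l : PlanL K A m := Fin.reverseInduction
    (motive := fun t => (Fin (t.val + 1) → K) → (Fin t.val → A) → ℝ)
    (fun S I => Finset.univ.sup' Finset.univ_nonempty fun a =>
      G.planPayoff y S (Fin.snoc (α := fun _ => A) I a))
    (fun t f S I => Finset.univ.sup' Finset.univ_nonempty fun a =>
      ∑ k', f (Fin.snoc (α := fun _ => K) S k') (Fin.snoc (α := fun _ => A) I a))
  have hlast : ∀ S I, l (Fin.last m) S I = Finset.univ.sup' Finset.univ_nonempty fun a =>
      G.planPayoff y S (Fin.snoc (α := fun _ => A) I a) := by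
    intro S I
    simp only [l, Fin.reverseInduction_last]
  have hstep : ∀ (t : Fin m) (S : Fin (t.val + 1) → K) (I : Fin t.val → A),
      l t.castSucc S I = Finset.univ.sup' Finset.univ_nonempty fun a =>
        ∑ k', l t.succ (Fin.snoc (α := fun _ => K) S k') (Fin.snoc (α := fun _ => A) I a) := by
    intro t S I
    simp only [l, Fin.reverseInduction_castSucc]
  refine ⟨l, ⟨fun t S I a => ?_, fun k a => ?_⟩, ?_⟩
  · rw [hstep]
    exact Finset.le_sup' (fun a => ∑ k', l t.succ (Fin.snoc (α := fun _ => K) S k')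
      (Fin.snoc (α := fun _ => A) I a)) (Finset.mem_univ a)
  · rw [hlast]
    have := Finset.le_sup' (fun a' => G.planPayoff y k
      (Fin.snoc (α := fun _ => A) (take (Nat.le_succ m) a) a')) (Finset.mem_univ (a (Fin.last m)))
    rw [show Fin.snoc (α := fun _ => A) (take (Nat.le_succ m) a) (a (Fin.last m)) = a from
      Fin.snoc_init_self a] at this
    exact this
  have h1 : ∀ (S : Fin (m + 1) → K) (I : Fin m → A), ∃ a,
      l (Fin.last m) S I = G.planPayoff y S (Fin.snoc (α := fun _ => A) I a) := by
    intro S I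
    obtain ⟨a, -, ha⟩ := Finset.exists_mem_eq_sup' Finset.univ_nonempty
      fun a => G.planPayoff y S (Fin.snoc (α := fun _ => A) I a)
    exact ⟨a, (hlast S I).trans ha⟩
  have h2 : ∀ (t : Fin m) (S : Fin (t.val + 1) → K) (I : Fin t.val → A), ∃ a,
      l t.castSucc S I = ∑ k', l t.succ (Fin.snoc (α := fun _ => K) S k')
        (Fin.snoc (α := fun _ => A) I a) := by
    intro t S I
    obtain ⟨a, -, ha⟩ := Finset.exists_mem_eq_sup' Finset.univ_nonempty
      fun a => ∑ k', l t.succ (Fin.snoc (α := fun _ => K) S k') (Fin.snoc (α := fun _ => A) I a)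
    exact ⟨a, (hstep t S I).trans ha⟩
  choose c1 hc1 using h1
  choose c2 hc2 using h2
  let c : (t : Fin (m + 1)) → (Fin (t.val + 1) → K) → (Fin t.val → A) → A :=
    Fin.lastCases (motive := fun t => (Fin (t.val + 1) → K) → (Fin t.val → A) → A) c1 c2
  refine ⟨fun t S I => vertex (c t S I), fun p => ?_⟩
  -- Along `c` the recursion for `l` holds with equality, so `-l` is a potential for the negated
  -- game and the upper bound there becomes the lower bound here.
  let G' : StochGame K A B := ⟨fun k => -G.M k, G.Q, G.Q_mem⟩
  have hG' : ∀ (σ : Strategy1 K A B m) (τ : Strategy2 A B m),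
      G'.dualPayoff (-α) p σ τ = -G.dualPayoff α p σ τ := by
    intro σ τ
    simp only [dualPayoff, ← Finset.sum_neg_distrib]
    refine Finset.sum_congr rfl fun k _ => Finset.sum_congr rfl fun a _ =>
      Finset.sum_congr rfl fun b _ => ?_
    rw [show G'.playProb p σ τ k a b = G.playProb p σ τ k a b from rfl, ← mul_neg]
    congr 1
    simp only [G', Pi.neg_apply, Matrix.neg_apply, Finset.sum_neg_distrib]
    ring
  have hpay : ∀ k a, G'.planPayoff y k a = -G.planPayoff y k a := by
    intro k a
    rw [planPayoff, planPayoff, ← mul_neg]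
    congr 1
    simp only [planGain, G', Matrix.neg_apply, neg_mul, Finset.sum_neg_distrib]
  have := G'.dualPayoff_le_of_potential (-α) p (fun t S I _ => vertex (c t S I)) y
    (fun t S I => -l t S I) (fun t S I J => ?_) fun S I J => ?_
  · rw [hG', neg_le] at this
    refine le_trans (le_of_eq ?_) this
    rw [← Finset.sum_neg_distrib]
    refine Finset.sum_congr rfl fun k _ => ?_
    rw [Pi.neg_apply]
    ring
  · rw [hvertex, Finset.sum_neg_distrib, hc2]
    simp only [c, Fin.lastCases_castSucc, le_refl]
  · rw [hvertex, hpay, hc1]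
    simp only [c, Fin.lastCases_last, le_refl]

end BestReply

/-! ### Averaging the strategies of player 2 -/

section Plans

variable {K A B : Type*} [Fintype B] {m : ℕ}

/-- The probability that player 2 plays `J` along the actions `I` of player 1. -/
def reach2 (τ : Strategy2 A B m) {t : ℕ} (h : t ≤ m + 1) (I : Fin t → A) (J : Fin t → B) : ℝ :=
  ∏ s : Fin t, (τ (Fin.castLE h s) (take s.isLt.le I) (take s.isLt.le J)).1 (J s)

theorem reach2_nonneg (τ : Strategy2 A B m) {t : ℕ} (h : t ≤ m + 1) (I : Fin t → A)
    (J : Fin t → B) : 0 ≤ reach2 τ h I J :=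
  Finset.prod_nonneg fun _ _ => (τ _ _ _).2.1 _

theorem reach2_snoc (τ : Strategy2 A B m) {t : ℕ} (h : t + 1 ≤ m + 1) (I : Fin (t + 1) → A)
    (J : Fin t → B) (b : B) :
    reach2 τ h I (Fin.snoc (α := fun _ => B) J b) =
      reach2 τ (Nat.le_of_succ_le h) (take (Nat.le_succ t) I) J *
        (τ ⟨t, h⟩ (take (Nat.le_succ t) I) J).1 b := by
  rw [reach2, Fin.prod_univ_castSucc]
  congr 1
  · refine Finset.prod_congr rfl fun s _ => ?_
    rw [Fin.snoc_castSucc, take_snoc (m := s.castSucc.val) s.isLt.le]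
    rfl
  · rw [Fin.snoc_last, take_snoc (m := (Fin.last t).val) le_rfl]
    rfl

/-- With `I` fixed, player 2's later actions can be summed out one at a time, the last one first. -/
theorem sum_reach2_take (τ : Strategy2 A B m) {n t : ℕ} (hn : n ≤ t) (h : t ≤ m + 1)
    (I : Fin t → A) (f : (Fin n → B) → ℝ) :
    ∑ J, reach2 τ h I J * f (take hn J) =
      ∑ J, reach2 τ (hn.trans h) (take hn I) J * f J := by
  induction t, hn using Nat.le_induction with
  | base => rfl
  | succ t hn ih =>
    rw [sum_snoc]
    refine Eq.trans ?_ (ih (Nat.le_of_succ_le h) (take (Nat.le_succ t) I))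
    refine Finset.sum_congr rfl fun J _ => ?_
    simp_rw [reach2_snoc, take_snoc hn]
    rw [← Finset.sum_mul, ← Finset.mul_sum,
      show ∑ b, (τ ⟨t, h⟩ (take (Nat.le_succ t) I) J).1 b = 1 from (τ _ _ _).2.2, mul_one]

theorem sum_reach2 (τ : Strategy2 A B m) {t : ℕ} (h : t ≤ m + 1) (I : Fin t → A) :
    ∑ J, reach2 τ h I J = 1 := by
  have := sum_reach2_take τ (Nat.zero_le t) h I fun _ => 1
  simp only [mul_one] at this
  rw [this, Fintype.sum_unique]
  exact Fin.prod_univ_zero _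

/-- The plan of player 2 induced by a behavior strategy by averaging over their own past actions. -/
def Strategy2.toPlanY (τ : Strategy2 A B m) : PlanY A B m := fun t I =>
  ⟨fun b => ∑ J, reach2 τ t.isLt.le I J * (τ t I J).1 b,
    fun b => Finset.sum_nonneg fun J _ => mul_nonneg (reach2_nonneg ..) ((τ _ _ _).2.1 _), by
      rw [Finset.sum_comm]
      simp_rw [← Finset.mul_sum]
      rw [← sum_reach2 τ t.isLt.le I]
      exact Finset.sum_congr rfl fun J _ => by
        rw [show ∑ b, (τ t I J).1 b = 1 from (τ _ _ _).2.2, mul_one]⟩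

theorem sum_reach2_apply (τ : Strategy2 A B m) (I : Fin (m + 1) → A) (t : Fin (m + 1))
    (g : B → ℝ) :
    ∑ J, reach2 τ le_rfl I J * g (J t) =
      ∑ b, g b * (τ.toPlanY t (take t.isLt.le I)).1 b := by
  have := sum_reach2_take τ t.isLt le_rfl I fun J => g (J (Fin.last t.val))
  refine Eq.trans this ?_
  rw [sum_snoc, Finset.sum_comm]
  refine Finset.sum_congr rfl fun b _ => ?_
  simp only [Strategy2.toPlanY, Finset.mul_sum, Fin.snoc_last]
  refine Finset.sum_congr rfl fun J _ => ?_
  rw [reach2_snoc, take_take]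
  ring

/-- Behavior strategies of player 1 that ignore the actions of player 2. -/
abbrev StatePlan (K A : Type*) [Fintype A] (m : ℕ) : Type _ :=
  (t : Fin (m + 1)) → (Fin (t.val + 1) → K) → (Fin t.val → A) → stdSimplex ℝ A

variable [Fintype A]

/-- The probability that player 1 plays `I` along the states `S`. -/
def reach1 (s : StatePlan K A m) {t : ℕ} (h : t ≤ m + 1) (S : Fin t → K) (I : Fin t → A) : ℝ :=
  ∏ i : Fin t, (s (Fin.castLE h i) (take i.isLt S) (take i.isLt.le I)).1 (I i)

theorem reach1_nonneg (s : StatePlan K A m) {t : ℕ} (h : t ≤ m + 1) (S : Fin t → K)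
    (I : Fin t → A) : 0 ≤ reach1 s h S I :=
  Finset.prod_nonneg fun _ _ => (s _ _ _).2.1 _

theorem reach1_snoc (s : StatePlan K A m) {t : ℕ} (h : t + 1 ≤ m + 1) (S : Fin (t + 1) → K)
    (I : Fin t → A) (a : A) :
    reach1 s h S (Fin.snoc (α := fun _ => A) I a) =
      reach1 s (Nat.le_of_succ_le h) (take (Nat.le_succ t) S) I * (s ⟨t, h⟩ S I).1 a := by
  rw [reach1, Fin.prod_univ_castSucc]
  congr 1
  · refine Finset.prod_congr rfl fun i _ => ?_
    rw [Fin.snoc_castSucc, take_snoc (m := i.castSucc.val) i.isLt.le]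
    rfl
  · rw [Fin.snoc_last, take_snoc (m := (Fin.last t).val) le_rfl]
    rfl

/-! ### Realization weights and the saddle point -/

variable [Fintype K]

/-- The expected payoff in terms of the realization weights of player 1 and a plan of player 2. -/
def weightPayoff (G : StochGame K A B) (α : K → ℝ)
    (x : (Fin (m + 1) → K) → (Fin (m + 1) → A) → ℝ)
    (y : (t : Fin (m + 1)) → (Fin t.val → A) → B → ℝ) : ℝ :=
  ∑ k, ∑ a, x k a * (G.transProd k a *
    (α (k 0) + ∑ t, ∑ b, G.M (k t) (a t) b * y t (take t.isLt.le a) b))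

/-- The realization weights of an initial law and a plan of player 1. -/
def weight (p : stdSimplex ℝ K) (s : StatePlan K A m) (k : Fin (m + 1) → K)
    (a : Fin (m + 1) → A) : ℝ :=
  p.1 (k 0) * reach1 s le_rfl k a

/-- Since `s` ignores player 2's actions, `reach` factors into one term per player; since the payoff
is additive over stages, only the law of each single action of player 2 matters. -/
theorem dualPayoff_eq_weightPayoff (G : StochGame K A B) (α : K → ℝ) (p : stdSimplex ℝ K)
    (s : StatePlan K A m) (τ : Strategy2 A B m) :
    G.dualPayoff α p (fun t S I _ => s t S I) τ =
      G.weightPayoff α (weight p s) fun t I => (τ.toPlanY t I).1 := by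
  rw [dualPayoff_eq_sum_reach]
  refine Finset.sum_congr rfl fun k _ => Finset.sum_congr rfl fun a _ => ?_
  simp_rw [← sum_reach2_apply]
  rw [Finset.sum_comm]
  simp_rw [← Finset.mul_sum]
  conv_rhs =>
    rw [← one_mul (α (k 0)), ← sum_reach2 τ le_rfl a, Finset.sum_mul, ← Finset.sum_add_distrib,
      Finset.mul_sum, Finset.mul_sum]
  refine Finset.sum_congr rfl fun b _ => ?_
  have : reach (fun t S I _ => s t S I) τ le_rfl k a b =
      reach1 s le_rfl k a * reach2 τ le_rfl a b := Finset.prod_mul_distrib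
  rw [this, weight]
  ring

omit [Fintype A] [Fintype K] in
theorem toPlanY_toStrategy2 (y : PlanY A B m) : y.toStrategy2.toPlanY = y := by
  funext t I
  ext b
  change ∑ J, reach2 y.toStrategy2 t.isLt.le I J * (y t I).1 b = (y t I).1 b
  rw [← Finset.sum_mul, sum_reach2, one_mul]

theorem exists_mixture {X : Type*} [Fintype X] (x x' : stdSimplex ℝ X) {u v : ℝ} (hu : 0 ≤ u)
    (hv : 0 ≤ v) : ∃ z : stdSimplex ℝ X, ∀ i, (u + v) * z.1 i = u * x.1 i + v * x'.1 i := by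
  rcases (add_nonneg hu hv).eq_or_lt with h | h
  -- At a history of total weight zero any mixed action works.
  · refine ⟨x, fun i => ?_⟩
    have hu0 : u = 0 := by linarith
    have hv0 : v = 0 := by linarith
    simp [hu0, hv0]
  · refine ⟨⟨fun i => u / (u + v) * x.1 i + v / (u + v) * x'.1 i,
      convex_stdSimplex ℝ X x.2 x'.2 (by positivity) (by positivity) (by field_simp)⟩,
      fun i => ?_⟩
    simp only
    field_simp

/-- Kuhn's argument: at each history, mix the two behavior strategies in proportion to the weights
with which they reach it. Induction on the stage shows that the weights then mix linearly. -/
theorem convex_range_weight :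
    Convex ℝ (Set.range fun q : stdSimplex ℝ K × StatePlan K A m => weight q.1 q.2) := by
  rintro _ ⟨⟨p, s⟩, rfl⟩ _ ⟨⟨p', s'⟩, rfl⟩ θ θ' hθ hθ' hsum
  obtain ⟨q, hq⟩ := exists_mixture p p' hθ hθ'
  rw [hsum] at hq
  simp only [one_mul] at hq
  have mix : ∀ (t : Fin (m + 1)) (S : Fin (t.val + 1) → K) (I : Fin t.val → A),
      ∃ z : stdSimplex ℝ A, ∀ a,
        (θ * (p.1 (S 0) * reach1 s t.isLt.le (take (Nat.le_succ _) S) I) +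
          θ' * (p'.1 (S 0) * reach1 s' t.isLt.le (take (Nat.le_succ _) S) I)) * z.1 a =
        θ * (p.1 (S 0) * reach1 s t.isLt.le (take (Nat.le_succ _) S) I) * (s t S I).1 a +
          θ' * (p'.1 (S 0) * reach1 s' t.isLt.le (take (Nat.le_succ _) S) I) * (s' t S I).1 a :=
    fun t S I => exists_mixture _ _
      (mul_nonneg hθ (mul_nonneg (p.2.1 _) (reach1_nonneg ..)))
      (mul_nonneg hθ' (mul_nonneg (p'.2.1 _) (reach1_nonneg ..)))
  choose z hz using mix
  have extend : ∀ (t : ℕ) (h : t + 1 ≤ m + 1) (S : Fin (t + 1) → K) (I : Fin t → A) (a : A),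
      q.1 (S 0) * reach1 z (Nat.le_of_succ_le h) (take (Nat.le_succ t) S) I =
        θ * (p.1 (S 0) * reach1 s (Nat.le_of_succ_le h) (take (Nat.le_succ t) S) I) +
          θ' * (p'.1 (S 0) * reach1 s' (Nat.le_of_succ_le h) (take (Nat.le_succ t) S) I) →
      q.1 (S 0) * reach1 z h S (Fin.snoc (α := fun _ => A) I a) =
        θ * (p.1 (S 0) * reach1 s h S (Fin.snoc (α := fun _ => A) I a)) +
          θ' * (p'.1 (S 0) * reach1 s' h S (Fin.snoc (α := fun _ => A) I a)) := by
    intro t h S I a hS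
    rw [reach1_snoc, reach1_snoc, reach1_snoc, ← mul_assoc, hS]
    refine (hz ⟨t, h⟩ S I a).trans ?_
    ring
  have key : ∀ (t : ℕ) (h : t + 1 ≤ m + 1) (S : Fin (t + 1) → K) (I : Fin t → A),
      q.1 (S 0) * reach1 z (Nat.le_of_succ_le h) (take (Nat.le_succ t) S) I =
        θ * (p.1 (S 0) * reach1 s (Nat.le_of_succ_le h) (take (Nat.le_succ t) S) I) +
          θ' * (p'.1 (S 0) * reach1 s' (Nat.le_of_succ_le h) (take (Nat.le_succ t) S) I) := by
    intro t
    induction t with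
    | zero =>
      intro h S I
      simp only [reach1, Fin.prod_univ_zero, mul_one, hq]
    | succ t ih =>
      intro h S I
      have := extend t (Nat.le_of_succ_le h) (take (Nat.le_succ _) S) (Fin.init I)
        (I (Fin.last t)) (ih (Nat.le_of_succ_le h) _ _)
      rwa [Fin.snoc_init_self] at this
  refine ⟨(q, z), ?_⟩
  funext k a
  have := extend m le_rfl k (Fin.init a) (a (Fin.last m)) (key m le_rfl _ _)
  rwa [Fin.snoc_init_self] at this

theorem isCompact_range_weight :
    IsCompact (Set.range fun q : stdSimplex ℝ K × StatePlan K A m => weight q.1 q.2) := by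
  refine isCompact_range ?_
  refine continuous_pi fun k => continuous_pi fun a => ?_
  refine ((continuous_apply _).comp (continuous_subtype_val.comp continuous_fst)).mul
    (continuous_finsetProd _ fun t _ => ?_)
  exact (continuous_apply _).comp (continuous_subtype_val.comp ((continuous_apply _).comp
    ((continuous_apply _).comp ((continuous_apply _).comp continuous_snd))))

theorem weightPayoff_combo_left (G : StochGame K A B) (α : K → ℝ)
    (x x' : (Fin (m + 1) → K) → (Fin (m + 1) → A) → ℝ)
    (y : (t : Fin (m + 1)) → (Fin t.val → A) → B → ℝ) (θ θ' : ℝ) :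
    G.weightPayoff α (θ • x + θ' • x') y =
      θ • G.weightPayoff α x y + θ' • G.weightPayoff α x' y := by
  simp only [weightPayoff, smul_eq_mul, Finset.mul_sum (s := (Finset.univ : Finset (Fin _ → K))),
    Finset.mul_sum (s := (Finset.univ : Finset (Fin (m + 1) → A))), ← Finset.sum_add_distrib]
  refine Finset.sum_congr rfl fun k _ => Finset.sum_congr rfl fun a _ => ?_
  simp only [Pi.add_apply, Pi.smul_apply, smul_eq_mul]
  ring

theorem weightPayoff_combo_right (G : StochGame K A B) (α : K → ℝ)
    (x : (Fin (m + 1) → K) → (Fin (m + 1) → A) → ℝ)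
    (y y' : (t : Fin (m + 1)) → (Fin t.val → A) → B → ℝ) {θ θ' : ℝ} (h : θ + θ' = 1) :
    G.weightPayoff α x (θ • y + θ' • y') =
      θ • G.weightPayoff α x y + θ' • G.weightPayoff α x y' := by
  simp only [weightPayoff, smul_eq_mul, Finset.mul_sum (s := (Finset.univ : Finset (Fin _ → K))),
    Finset.mul_sum (s := (Finset.univ : Finset (Fin (m + 1) → A))), ← Finset.sum_add_distrib]
  refine Finset.sum_congr rfl fun k _ => Finset.sum_congr rfl fun a _ => ?_
  have : ∑ t, ∑ b, G.M (k t) (a t) b * (θ • y + θ' • y') t (take t.isLt.le a) b =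
      θ * ∑ t, ∑ b, G.M (k t) (a t) b * y t (take t.isLt.le a) b +
        θ' * ∑ t, ∑ b, G.M (k t) (a t) b * y' t (take t.isLt.le a) b := by
    simp only [Finset.mul_sum, ← Finset.sum_add_distrib]
    refine Finset.sum_congr rfl fun t _ => Finset.sum_congr rfl fun b _ => ?_
    simp only [Pi.add_apply, Pi.smul_apply, smul_eq_mul]
    ring
  rw [this]
  -- The `α` term does not involve the plan, so the payoff is affine and needs `θ + θ' = 1`.
  linear_combination (-x k a * G.transProd k a * α (k 0)) * h

theorem stdSimplex_nonempty (X : Type*) [Fintype X] [Nonempty X] : (stdSimplex ℝ X).Nonempty := by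
  classical
  exact ⟨_, single_mem_stdSimplex ℝ (Classical.arbitrary X)⟩

/-- A saddle point of the payoff in realization weights. -/
theorem exists_saddle [Nonempty K] [Nonempty A] [Nonempty B] (G : StochGame K A B) (m : ℕ)
    (α : K → ℝ) :
    ∃ (p : stdSimplex ℝ K) (s : StatePlan K A m) (y : PlanY A B m),
      ∀ (p' : stdSimplex ℝ K) (s' : StatePlan K A m) (y' : PlanY A B m),
        G.weightPayoff α (weight p' s') (fun t I => (y t I).1) ≤
          G.weightPayoff α (weight p s) (fun t I => (y' t I).1) := by
  let X := Set.range fun q : stdSimplex ℝ K × StatePlan K A m => weight q.1 q.2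
  let Y : Set ((t : Fin (m + 1)) → (Fin t.val → A) → B → ℝ) :=
    Set.univ.pi fun t => Set.univ.pi fun _ => stdSimplex ℝ B
  have neX : X.Nonempty := by
    obtain ⟨p, hp⟩ := stdSimplex_nonempty K
    obtain ⟨a, ha⟩ := stdSimplex_nonempty A
    exact ⟨_, ⟨(⟨p, hp⟩, fun _ _ _ => ⟨a, ha⟩), rfl⟩⟩
  have neY : Y.Nonempty := Set.univ_pi_nonempty_iff.2 fun _ =>
    Set.univ_pi_nonempty_iff.2 fun _ => stdSimplex_nonempty B
  have cY : Convex ℝ Y := convex_pi fun _ _ => convex_pi fun _ _ => convex_stdSimplex ℝ B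
  have kY : IsCompact Y := isCompact_univ_pi fun _ => isCompact_univ_pi fun _ =>
    isCompact_stdSimplex ℝ B
  obtain ⟨y, hy, _, ⟨⟨p, s⟩, rfl⟩, h⟩ := Sion.exists_isSaddlePointOn (X := Y) (Y := X)
    (f := fun y x => G.weightPayoff α x y) neY cY kY
    (fun x _ => (Continuous.lowerSemicontinuous (by unfold weightPayoff; fun_prop)).lowerSemicontinuousOn _)
    (fun x _ => ConvexOn.quasiconvexOn ⟨cY, fun _ _ _ _ _ _ _ _ h =>
      (G.weightPayoff_combo_right α x _ _ h).le⟩)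
    convex_range_weight neX isCompact_range_weight
    (fun y _ => (Continuous.upperSemicontinuous (by unfold weightPayoff; fun_prop)).upperSemicontinuousOn _)
    (fun y _ => ConcaveOn.quasiconcaveOn ⟨convex_range_weight, fun _ _ _ _ _ _ _ _ _ =>
      (G.weightPayoff_combo_left α _ _ y _ _).ge⟩)
  exact ⟨p, s, fun t I => ⟨y t I, hy t trivial I trivial⟩, fun p' s' y' =>
    h _ (fun t _ I _ => (y' t I).2) _ ⟨(p', s'), rfl⟩⟩

end Plans

end StochGame

end

open StochGame in
theorem mainTheorem10 {K A B : Type*} [Fintype K] [Fintype A] [Fintype B]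
    [Nonempty K] [Nonempty A] [Nonempty B]
    (G : StochGame K A B) (m : ℕ) (α : K → ℝ) :
    ∃ w : ℝ, G.IsDualValue m α w ∧
      IsLeast {lhat : ℝ | ∃ (y : StochGame.PlanY A B m) (l : StochGame.PlanL K A m),
        G.DualFeasible α y l lhat} w := by
  obtain ⟨p, s, y, hsaddle⟩ := G.exists_saddle m α
  let σ : Strategy1 K A B m := fun t S I _ => s t S I
  obtain ⟨l, hl, c, hc⟩ := G.exists_treeFeasible_le_dualPayoff α y
  have hσ : ∀ τ, G.weightPayoff α (weight p s) (fun t I => (y t I).1) ≤ G.dualPayoff α p σ τ := by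
    intro τ
    rw [G.dualPayoff_eq_weightPayoff]
    exact hsaddle ..
  have hfeas : G.DualFeasible α y l (G.weightPayoff α (weight p s) fun t I => (y t I).1) := by
    refine ⟨fun k => ?_, hl⟩
    classical
    -- The point mass at `k` isolates the root constraint at `k`; the saddle inequality bounds the
    -- best reply from there.
    have h := hc ⟨_, single_mem_stdSimplex ℝ k⟩
    rw [G.dualPayoff_eq_weightPayoff, toPlanY_toStrategy2] at h
    refine le_trans (le_of_eq ?_) (h.trans (hsaddle ..))
    simp [Pi.single_apply]
  have heq := le_antisymm (hfeas.dualPayoff_le p σ) (hσ y.toStrategy2)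
  refine ⟨_, ⟨⟨⟨p, σ, ⟨_, heq⟩, ?_⟩, ?_⟩, ⟨⟨y.toStrategy2, ⟨(p, σ), heq⟩, ?_⟩, ?_⟩⟩,
    ⟨y, l, hfeas⟩, ?_⟩
  · rintro _ ⟨τ, rfl⟩
    exact hσ τ
  · rintro v ⟨p', σ', hv⟩
    exact (hv.2 ⟨y.toStrategy2, rfl⟩).trans (hfeas.dualPayoff_le p' σ')
  · rintro _ ⟨⟨p', σ'⟩, rfl⟩
    exact hfeas.dualPayoff_le p' σ'
  · rintro v ⟨τ, hv⟩
    exact (hσ τ).trans (hv.2 ⟨(p, σ), rfl⟩)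
  · rintro lhat ⟨y', l', h⟩
    exact (hσ y'.toStrategy2).trans (h.dualPayoff_le p σ)
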